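/- Let $k\ge 2$ be an integer and let $\Omega(k)$ be the number of prime factors of $k$, counted with multiplicity. A complete directed graph has, for any two distinct vertices $x,y$, both directed edges $xy$ and $yx$, and has no loops. A directed cycle consists of $\ell\ge 2$ distinct vertices $v_1,\dots,v_\ell$ together with the edges $v_1v_2,\dots,v_{\ell-1}v_\ell,v_\ell v_1$ (so $\ell=2$ is allowed); its weight is the sum of the weights of its vertices and edges. Every finite complete directed graph of order at least $k+2\Omega(k)$ whose vertices and edges carry weights in $\mathbb{Z}_k$ contains a directed cycle of weight $0$ in $\mathbb{Z}_k$. In particular this holds when only the edges carry weights, that is, when all vertex weights are $0$. Consequently there is a largest order $f(k)$ of a complete directed graph, with integer weights on its vertices and edges, that contains no directed cycle of weight divisible by $k$, and $f(k)<k+2\Omega(k)$. -/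

import Mathlib

namespace ZeroCycle

/-- The complete directed graph on `V`: all ordered pairs of distinct vertices are edges, and there
are no loops. -/
def completeDigraph (V : Type*) : Digraph V where
  Adj x y := x ≠ y

/-- The ordered pairs of cyclically consecutive vertices of `c = [v₁, …, vₗ]`, that is
`(v₁, v₂), …, (vₗ₋₁, vₗ), (vₗ, v₁)`. -/
def arcs {V : Type*} (c : List V) : List (V × V) :=
  c.zip (c.rotate 1)

/-- `c = [v₁, …, vₗ]` lists, in cyclic order, the vertices of a directed cycle of `G`. Length two
(a pair of opposite edges) is allowed. -/
structure IsDirectedCycle {V : Type*} (G : Digraph V) (c : List V) : Prop where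
  two_le_length : 2 ≤ c.length
  nodup : c.Nodup
  adj : ∀ e ∈ arcs c, G.Adj e.1 e.2

/-- The weight of the cycle `c`: the sum of the weights of its vertices and of its edges. Only the
values of `wE` at pairs of distinct vertices matter. -/
def cycleWeight {V M : Type*} [AddCommMonoid M] (wV : V → M) (wE : V → V → M) (c : List V) : M :=
  (c.map wV).sum + ((arcs c).map fun e => wE e.1 e.2).sum

/-- The orders `n` of those complete directed graphs, with integer weights on vertices and edges,
that contain no directed cycle of weight divisible by `k`. -/
def avoidingOrders (k : ℕ) : Set ℕ :=
  {n | ∃ (wV : Fin n → ℤ) (wE : Fin n → Fin n → ℤ),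
    ¬ ∃ c : List (Fin n), IsDirectedCycle (completeDigraph (Fin n)) c ∧
      (k : ℤ) ∣ cycleWeight wV wE c}

/-- `f k`, the largest order of a complete directed graph with integer weights that contains no
directed cycle of weight divisible by `k`. -/
noncomputable def f (k : ℕ) : ℕ :=
  sSup (avoidingOrders k)

end ZeroCycle

/-!
The bound proved is stronger than required: edge weights in a finite cyclic group `G` on more than
`|G|` vertices always admit a directed cycle of weight zero. Vertex weights are absorbed into the
edges leaving the vertex.

Fix a root `u` and let `A b` be the set of weights of paths from `u` to `b` through a set `X` of
interior vertices. Start from `X = ∅` and enlarge `X` as long as every remaining `b` keeps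
`|A b| ≥ |X| + 1`. If `A b` becomes all of `G`, the edge `b u` closes a zero cycle. Moving `c` into
`X` adds `A c + w c b` to `A b`. So if no single vertex can be moved, then all the `A b` have exactly
`|X| + 1` elements and each remaining `c` has an edge to some other remaining `b` which translates,
that is, `A c + w c b = A b`.

Following translating edges one reaches a cycle, whose weight is a period of every `A c` on the way;
unless it is a zero cycle, every `A c` is periodic (`exists_period`). Two distinct periodic sets of
equal size in a cyclic group have a union at least two elements larger
(`ncard_add_two_le_ncard_union`). Hence, if some edge `c d` does not translate, `c` and `d` can be
moved into `X` together. Otherwise all remaining edges translate, so all the `A b` have the same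
stabilizer `H`, and subtracting a potential puts the remaining weights into `H`
(`HasZeroCycle.of_subgroup`). As `|X| + 1 ≤ |G| - |H|`, more than `|H|` vertices remain, and
induction on the order of the group finishes the proof (`hasZeroCycle_of_card_lt`).
-/

namespace ZeroCycle

open Pointwise

/-! ### Walk weights and cycle weights -/

section Walk

variable {V G : Type*} [AddCommGroup G] (w : V → V → G)

/-- The weight of the walk from `a` to `b` whose interior vertices are, in order, those of `l`. -/
def walkWeight : V → List V → V → G
  | a, [], b => w a b
  | a, x :: l, b => w a x + walkWeight x l b

theorem walkWeight_concat (a : V) (l : List V) (c b : V) :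
    walkWeight w a (l ++ [c]) b = walkWeight w a l c + w c b := by
  induction l generalizing a with
  | nil => simp [walkWeight]
  | cons x l ih => simp [walkWeight, ih, add_assoc]

theorem sum_zip_eq_walkWeight (a : V) (l : List V) (b : V) :
    (((a :: l).zip (l ++ [b])).map fun e => w e.1 e.2).sum = walkWeight w a l b := by
  induction l generalizing a with
  | nil => simp [walkWeight]
  | cons x l ih => simpa [walkWeight] using ih x

theorem sum_arcs_cons (a : V) (l : List V) :
    ((arcs (a :: l)).map fun e => w e.1 e.2).sum = walkWeight w a l a := by
  simpa [arcs] using sum_zip_eq_walkWeight w a l a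

theorem sum_map_fst_arcs (t : V → G) (c : List V) :
    ((arcs c).map fun e => t e.1).sum = (c.map t).sum := by
  have h : (arcs c).map Prod.fst = c := List.map_fst_zip (by simp)
  conv_rhs => rw [← h]
  simp [Function.comp_def]

theorem sum_map_snd_arcs (t : V → G) (c : List V) :
    ((arcs c).map fun e => t e.2).sum = (c.map t).sum := by
  have h : (arcs c).map Prod.snd = c.rotate 1 := List.map_snd_zip (by simp)
  have h' : ((c.rotate 1).map t).sum = (c.map t).sum :=
    ((List.rotate_perm c 1).map t).sum_eq
  rw [← h', ← h]
  simp [Function.comp_def]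

theorem ne_of_mem_arcs {c : List V} (hl : 2 ≤ c.length) (hn : c.Nodup) {e : V × V}
    (he : e ∈ arcs c) : e.1 ≠ e.2 := by
  obtain ⟨i, hi, rfl⟩ := List.getElem_of_mem he
  simp only [arcs, List.length_zip, List.length_rotate, min_self] at hi
  simp only [arcs, List.getElem_zip, List.getElem_rotate, ne_eq, hn.getElem_inj_iff]
  intro h
  rcases Nat.lt_or_ge (i + 1) c.length with h1 | h1
  · rw [Nat.mod_eq_of_lt h1] at h
    omega
  · rw [show i + 1 = c.length by omega, Nat.mod_self] at h
    omega

/-- Some directed cycle through vertices of `S` has edge weights summing to zero. -/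
def HasZeroCycle (S : Finset V) : Prop :=
  ∃ c : List V, (∀ x ∈ c, x ∈ S) ∧ 2 ≤ c.length ∧ c.Nodup ∧
    ((arcs c).map fun e => w e.1 e.2).sum = 0

theorem HasZeroCycle.mono {w : V → V → G} {S T : Finset V} (h : HasZeroCycle w S) (hST : S ⊆ T) :
    HasZeroCycle w T := by
  obtain ⟨c, hc, h⟩ := h
  exact ⟨c, fun x hx => hST (hc x hx), h⟩

/-- Subtracting the differences of a potential `t` from the edge weights changes no cycle weight,
so a zero cycle can be sought after this has brought all weights into a subgroup `H`. -/
theorem HasZeroCycle.of_subgroup {H : AddSubgroup G} {S : Finset V} (t : V → G) (w' : V → V → H)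
    (hw : ∀ a ∈ S, ∀ b ∈ S, a ≠ b → w a b = w' a b + (t b - t a)) (h : HasZeroCycle w' S) :
    HasZeroCycle w S := by
  obtain ⟨c, hcS, hl, hn, hs⟩ := h
  refine ⟨c, hcS, hl, hn, ?_⟩
  have h1 : (arcs c).map (fun e => w e.1 e.2) =
      (arcs c).map fun e => (w' e.1 e.2 : G) + (t e.2 - t e.1) := by
    refine List.map_congr_left fun e he => hw _ ?_ _ ?_ (ne_of_mem_arcs hl hn he)
    · exact hcS _ (List.of_mem_zip he).1
    · exact hcS _ (List.mem_rotate.1 (List.of_mem_zip he).2)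
  have h2 : ((arcs c).map fun e => (w' e.1 e.2 : G)).sum = 0 := by
    have := congrArg H.subtype hs
    rw [map_list_sum, List.map_map] at this
    simpa [Function.comp_def] using this
  have h3 : ((arcs c).map fun e => t e.2 - t e.1).sum = 0 := by
    have := Multiset.sum_map_sub (m := (arcs c : Multiset (V × V))) (f := fun e => t e.2)
      (g := fun e => t e.1)
    simp only [Multiset.map_coe, Multiset.sum_coe] at this ⊢
    rw [this, sum_map_fst_arcs, sum_map_snd_arcs, sub_self]
  rw [h1, List.sum_map_add, h2, h3, add_zero]

end Walk

/-! ### Weights of paths from a root -/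

section Reach

variable {V G : Type*} [AddCommGroup G] (w : V → V → G)

/-- The weights of the directed paths from `u` to `b` all of whose interior vertices lie in `X`.
It is meant for `b ∉ insert u X`, when the walks in question are indeed paths. -/
def pathWeights (u : V) (X : Finset V) (b : V) : Set G :=
  {g | ∃ l : List V, l.Nodup ∧ u ∉ l ∧ (∀ x ∈ l, x ∈ X) ∧ walkWeight w u l b = g}

theorem pathWeights_nonempty (u : V) (X : Finset V) (b : V) : (pathWeights w u X b).Nonempty :=
  ⟨_, [], by simp, by simp, by simp, rfl⟩

theorem pathWeights_mono {u : V} {X Y : Finset V} (h : X ⊆ Y) (b : V) :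
    pathWeights w u X b ⊆ pathWeights w u Y b := by
  rintro g ⟨l, h1, h2, h3, rfl⟩
  exact ⟨l, h1, h2, fun x hx => h (h3 x hx), rfl⟩

theorem vadd_pathWeights_subset [DecidableEq V] {u : V} {X : Finset V} {c : V} (hcu : c ≠ u)
    (hcX : c ∉ X) (b : V) :
    w c b +ᵥ pathWeights w u X c ⊆ pathWeights w u (insert c X) b := by
  rintro _ ⟨_, ⟨l, h1, h2, h3, rfl⟩, rfl⟩
  refine ⟨l ++ [c], ?_, ?_, ?_, ?_⟩
  · rw [List.nodup_append]
    refine ⟨h1, by simp, fun x hx y hy => ?_⟩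
    rw [List.mem_singleton.1 hy]
    rintro rfl
    exact hcX (h3 _ hx)
  · simp [h2, hcu.symm]
  · intro x hx
    rcases List.mem_append.1 hx with hx | hx
    · exact Finset.mem_insert_of_mem (h3 x hx)
    · simp [List.mem_singleton.1 hx]
  · simp [walkWeight_concat, add_comm]

theorem hasZeroCycle_of_neg_mem_pathWeights {u b : V} {X S : Finset V} (hu : u ∈ S) (hb : b ∈ S)
    (hX : X ⊆ S) (hbu : b ≠ u) (hbX : b ∉ X) (h : -w b u ∈ pathWeights w u X b) :
    HasZeroCycle w S := by
  obtain ⟨l, h1, h2, h3, h4⟩ := h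
  refine ⟨u :: (l ++ [b]), ?_, by simp, ?_, ?_⟩
  · simp only [List.mem_cons, List.mem_append, List.not_mem_nil, or_false]
    rintro x (rfl | hx | rfl)
    exacts [hu, hX (h3 x hx), hb]
  · rw [List.nodup_cons, List.nodup_append]
    refine ⟨by simp [h2, hbu.symm], h1, by simp, fun x hx y hy => ?_⟩
    rw [List.mem_singleton.1 hy]
    rintro rfl
    exact hbX (h3 _ hx)
  · rw [sum_arcs_cons, walkWeight_concat, h4, neg_add_cancel]

end Reach

/-! ### Periodic sets in finite abelian groups -/

section Group

variable {G : Type*} [AddCommGroup G]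

/-- Two distinct sets of equal size differ in at least two elements each way, if both are periodic.
This is where the group has to be cyclic: in a Klein four-group, `{0, h}` and `{0, h'}` are
periodic. -/
theorem ncard_add_two_le_ncard_union [Finite G] [IsAddCyclic G] {A B : Set G} {h h' : G}
    (hh : h ≠ 0) (hh' : h' ≠ 0) (hA : h +ᵥ A = A) (hB : h' +ᵥ B = B)
    (hcard : A.ncard = B.ncard) (hAB : A ≠ B) : A.ncard + 2 ≤ (A ∪ B).ncard := by
  classical
  by_contra hlt
  have e1 := Set.ncard_sdiff_add_ncard A B
  have e2 := Set.ncard_sdiff_add_ncard B A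
  rw [Set.union_comm B A] at e2
  have p1 : (A \ B).ncard ≠ 0 := by
    rw [← Nat.pos_iff_ne_zero, Set.ncard_pos, Set.sdiff_nonempty]
    exact fun hs => hAB (Set.eq_of_subset_of_ncard_le hs hcard.ge)
  obtain ⟨a, ha⟩ := Set.ncard_eq_one.1 (show (A \ B).ncard = 1 by omega)
  obtain ⟨b, hb⟩ := Set.ncard_eq_one.1 (show (B \ A).ncard = 1 by omega)
  have haA : a ∈ A ∧ a ∉ B := by simpa using (ha ▸ Set.mem_singleton a : a ∈ A \ B)
  have hbB : b ∈ B ∧ b ∉ A := by simpa using (hb ▸ Set.mem_singleton b : b ∈ B \ A)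
  have ua : ∀ x, x ∈ A → x ≠ a → x ∈ B := fun x hx hxa => by
    by_contra hxB
    exact hxa (ha.subset ⟨hx, hxB⟩)
  have ub : ∀ x, x ∈ B → x ∉ A → x = b := fun x hx hxA => hb.subset ⟨hx, hxA⟩
  have mem_iff : ∀ {C : Set G} {s : G}, s +ᵥ C = C → ∀ x, s + x ∈ C ↔ x ∈ C := by
    intro C s hs x
    conv_lhs => rw [← hs]
    exact Set.vadd_mem_vadd_set_iff
  -- The corner opposite to `a` in a parallelogram spanned by periods of `A` and `B` must be `b`.
  have key : ∀ s s' : G, s ≠ 0 → s' ≠ 0 → s +ᵥ A = A → s' +ᵥ B = B → s + (s' + a) = b := by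
    intro s s' hs hs' hsA hsB
    have q1 : s + a ∈ B := ua _ ((mem_iff hsA a).2 haA.1) (by simpa using hs)
    have q2 : s' + a ∉ B := fun h => haA.2 ((mem_iff hsB a).1 h)
    have q3 : s' + a ∉ A := fun h => q2 (ua _ h (by simpa using hs'))
    refine ub _ ?_ fun h => q3 ((mem_iff hsA _).1 h)
    rw [add_left_comm]
    exact (mem_iff hsB _).2 q1
  have neg_vadd : ∀ {C : Set G} {s : G}, s +ᵥ C = C → -s +ᵥ C = C := fun {C s} hs => by
    rw [neg_vadd_eq_iff, hs]
  have k1 := key h h' hh hh' hA hB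
  have k2 := key (-h) h' (neg_ne_zero.2 hh) hh' (neg_vadd hA) hB
  have k3 := key h (-h') hh (neg_ne_zero.2 hh') hA (neg_vadd hB)
  -- Hence both periods have order two, and a cyclic group has only one such element.
  have o1 : h = -h := add_right_cancel (k1.trans k2.symm)
  have o2 : h' = -h' := add_right_cancel (add_left_cancel (k1.trans k3.symm))
  have : h = h' := by
    by_contra hne
    have := Fintype.ofFinite G
    have hle := IsAddCyclic.card_nsmul_eq_zero_le (α := G) (n := 2) (by norm_num)
    have hsub : ({0, h, h'} : Finset G) ⊆ Finset.univ.filter fun x : G => 2 • x = 0 := by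
      intro x hx
      simp only [Finset.mem_insert, Finset.mem_singleton] at hx
      simp only [Finset.mem_filter, Finset.mem_univ, true_and, two_nsmul]
      rcases hx with rfl | rfl | rfl
      · simp
      · exact eq_neg_iff_add_eq_zero.1 o1
      · exact eq_neg_iff_add_eq_zero.1 o2
    have h3 : ({0, h, h'} : Finset G).card = 3 :=
      Finset.card_eq_three.2 ⟨0, h, h', hh.symm, hh'.symm, hne, rfl⟩
    have := Finset.card_le_card hsub
    omega
  subst this
  rw [← add_assoc, eq_neg_iff_add_eq_zero.1 o1, zero_add] at k1
  exact haA.2 (k1 ▸ hbB.1)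

theorem card_stabilizer_add_ncard_le [Finite G] {A : Set G} (hA : A ≠ Set.univ) :
    Nat.card (AddAction.stabilizer G A) + A.ncard ≤ Nat.card G := by
  obtain ⟨x, hx⟩ := (Set.ne_univ_iff_exists_notMem A).1 hA
  rw [← Set.ncard_add_ncard_compl A, add_comm]
  refine Nat.add_le_add_left ?_ _
  have hinj := Set.ncard_image_of_injective (AddAction.stabilizer G A : Set G)
    (add_left_injective x)
  rw [show Nat.card (AddAction.stabilizer G A) = _ from hinj.symm]
  refine Set.ncard_le_ncard ?_
  rintro _ ⟨s, hs, rfl⟩ hmem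
  have hs' : s +ᵥ A = A := hs
  have hmem' : s +ᵥ x ∈ s +ᵥ A := by rw [hs']; exact hmem
  exact hx (Set.vadd_mem_vadd_set_iff.1 hmem')

end Group

/-! ### Zero cycles for weights in a cyclic group -/

section Main

variable {V G : Type*} [AddCommGroup G] (w : V → V → G)

/-- If every vertex `c` of `R` has an edge to another vertex `b` of `R` along which the family `A`
is translated, `w c b +ᵥ A c = A b`, then following these edges leads into a cycle; its weight is a
period of every `A c` met on the way. -/
theorem exists_period [Finite V] {R : Finset V} (A : V → Set G) (hzero : ¬ HasZeroCycle w R)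
    (hstep : ∀ c ∈ R, ∃ b ∈ R, b ≠ c ∧ w c b +ᵥ A c = A b) {c : V} (hc : c ∈ R) :
    ∃ h : G, h ≠ 0 ∧ h +ᵥ A c = A c := by
  classical
  have hstep' : ∀ c, ∃ b, c ∈ R → b ∈ R ∧ b ≠ c ∧ w c b +ᵥ A c = A b := fun c => by
    by_cases hc : c ∈ R
    · obtain ⟨b, hb⟩ := hstep c hc
      exact ⟨b, fun _ => hb⟩
    · exact ⟨c, fun h => absurd h hc⟩
  choose φ hφ using hstep'
  have hR : ∀ {a : V}, a ∈ R → ∀ n, φ^[n] a ∈ R := fun {a} ha n => by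
    induction n with
    | zero => exact ha
    | succ n ih => rw [Function.iterate_succ_apply']; exact (hφ _ ih).1
  have htrans : ∀ {a : V}, a ∈ R → ∀ n,
      walkWeight w a ((List.range n).map fun i => φ^[i + 1] a) (φ^[n + 1] a) +ᵥ A a =
        A (φ^[n + 1] a) := fun {a} ha n => by
    induction n with
    | zero => simpa [walkWeight] using (hφ a ha).2.2
    | succ n ih =>
      rw [List.range_succ, List.map_append, List.map_singleton, walkWeight_concat, add_comm,
        add_vadd, ih, Function.iterate_succ_apply' φ (n + 1)]
      exact (hφ _ (hR ha _)).2.2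
  obtain ⟨i, j, hij, he⟩ : ∃ i j, i < j ∧ φ^[i] c = φ^[j] c := by
    obtain ⟨i, j, hne, he⟩ := Finite.exists_ne_map_eq_of_infinite fun n : ℕ => φ^[n] c
    rcases hne.lt_or_gt with h | h
    exacts [⟨i, j, h, he⟩, ⟨j, i, h, he.symm⟩]
  set p := φ^[i] c with hp
  have hpR : p ∈ R := hR hc i
  have hper : p ∈ Function.periodicPts φ := by
    refine Function.mk_mem_periodicPts (Nat.sub_pos_of_lt hij) ?_
    rw [Function.IsPeriodicPt, Function.IsFixedPt, hp, ← Function.iterate_add_apply,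
      Nat.sub_add_cancel hij.le, ← he]
  have hpos := Function.minimalPeriod_pos_of_mem_periodicPts hper
  have hne1 : Function.minimalPeriod φ p ≠ 1 := fun h =>
    (hφ p hpR).2.1 (Function.minimalPeriod_eq_one_iff_isFixedPt.1 h)
  obtain ⟨n, hn⟩ : ∃ n, Function.minimalPeriod φ p = n + 2 :=
    ⟨Function.minimalPeriod φ p - 2, by omega⟩
  have hret : φ^[n + 2] p = p := hn ▸ Function.iterate_minimalPeriod
  set σ := walkWeight w p ((List.range (n + 1)).map fun i => φ^[i + 1] p) p with hσ
  have hσp : σ +ᵥ A p = A p := by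
    have := htrans hpR (n + 1)
    rwa [hret] at this
  have hσ0 : σ ≠ 0 := by
    intro h0
    refine hzero ⟨p :: (List.range (n + 1)).map fun i => φ^[i + 1] p, ?_, by simp, ?_, ?_⟩
    · simp only [List.mem_cons, List.mem_map]
      rintro x (rfl | ⟨i, -, rfl⟩)
      exacts [hpR, hR hpR _]
    · have hl : p :: (List.range (n + 1)).map (fun i => φ^[i + 1] p) =
          (List.range (n + 2)).map fun i => φ^[i] p := by
        rw [List.range_succ_eq_map (n := n + 1)]
        simp [Function.comp_def]
      rw [hl]
      refine List.Nodup.map_on (fun x hx y hy hxy => ?_) List.nodup_range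
      refine Function.iterate_injOn_Iio_minimalPeriod (f := φ) (x := p) ?_ ?_ hxy
      · simpa [hn] using hx
      · simpa [hn] using hy
    · rw [sum_arcs_cons]
      exact h0
  refine ⟨σ, hσ0, ?_⟩
  have ht : ∃ t : G, t +ᵥ A c = A p := by
    rcases i with _ | i
    · exact ⟨0, by simp [hp]⟩
    · exact ⟨_, htrans hc i⟩
  obtain ⟨t, ht⟩ := ht
  rw [← ht, vadd_comm] at hσp
  exact vadd_left_cancel t hσp

/-- Edge weights in a cyclic group `G` on at least `|G| + 1` vertices always admit a zero cycle. -/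
theorem hasZeroCycle_of_card_lt [Finite V] {G : Type} [AddCommGroup G] [Finite G] [IsAddCyclic G]
    (w : V → V → G) (S : Finset V) (hS : Nat.card G < S.card) : HasZeroCycle w S := by
  classical
  induction hN : Nat.card G using Nat.strong_induction_on generalizing G S with
  | _ N ih =>
  subst hN
  by_contra hzero
  have hGpos : 0 < Nat.card G := Nat.card_pos
  obtain ⟨u, hu⟩ : S.Nonempty := Finset.card_pos.1 (by omega)
  -- Take `X` largest such that every remaining vertex is reached with `|X| + 1` weights. The bound
  -- `|X| + 1 ≤ |G|` ensures that a vertex remains, so that the condition is not vacuous.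
  let F : Finset (Finset V) := (S.erase u).powerset.filter fun X =>
    X.card + 1 ≤ Nat.card G ∧ ∀ b ∈ S.erase u \ X, X.card + 1 ≤ (pathWeights w u X b).ncard
  have hF0 : ∅ ∈ F := by
    simp only [F, Finset.mem_filter, Finset.empty_mem_powerset, true_and, Finset.card_empty]
    exact ⟨by omega, fun b _ => (Set.ncard_pos).2 (pathWeights_nonempty w u ∅ b)⟩
  obtain ⟨X, hXF, hmax⟩ := Finset.exists_max_image F Finset.card ⟨∅, hF0⟩
  have hXF' := hXF
  simp only [F, Finset.mem_filter, Finset.mem_powerset] at hXF'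
  obtain ⟨hXS, hXN, hXw⟩ := hXF'
  have hXS' : X ⊆ S := hXS.trans (Finset.erase_subset _ _)
  set R := S.erase u \ X with hRdef
  have hRcard : R.card + X.card + 1 = S.card := by
    have : R.card + X.card = (S.erase u).card := Finset.card_sdiff_add_card_eq_card hXS
    have := Finset.card_erase_add_one hu
    omega
  have hRmem : ∀ {b : V}, b ∈ R → b ∈ S ∧ b ≠ u ∧ b ∉ X := fun {b} hb => by
    simp only [hRdef, Finset.mem_sdiff, Finset.mem_erase] at hb
    exact ⟨hb.1.2, hb.1.1, hb.2⟩
  have hRS : R ⊆ S := fun b hb => (hRmem hb).1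
  obtain ⟨r, hr⟩ : R.Nonempty := Finset.card_pos.1 (by omega)
  have hproper : ∀ b ∈ R, pathWeights w u X b ≠ Set.univ := fun b hb h => by
    obtain ⟨h1, h2, h3⟩ := hRmem hb
    exact hzero (hasZeroCycle_of_neg_mem_pathWeights w hu h1 hXS' h2 h3 (h ▸ Set.mem_univ _))
  have hvcard : ∀ (g : G) (A : Set G), (g +ᵥ A).ncard = A.ncard := fun g A =>
    Set.ncard_image_of_injective A (AddAction.injective g)
  have hextend : ∀ {Y : Finset V}, Y ⊆ S.erase u → X.card < Y.card → Y.card + 1 ≤ Nat.card G →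
      ∃ b ∈ S.erase u \ Y, (pathWeights w u Y b).ncard < Y.card + 1 := by
    intro Y hY hlt hYN
    by_contra! hcon
    have : Y ∈ F := by
      simp only [F, Finset.mem_filter, Finset.mem_powerset]
      exact ⟨hY, hYN, hcon⟩
    have := hmax Y this
    omega
  have hXlt : X.card + 1 < Nat.card G := by
    refine lt_of_le_of_ne hXN fun h => hproper r hr ?_
    refine Set.eq_of_subset_of_ncard_le (Set.subset_univ _) ?_
    rw [Set.ncard_univ, ← h]
    exact hXw r hr
  -- No single vertex can be added, so each remaining vertex has a translating edge.
  have htight : ∀ c ∈ R, (pathWeights w u X c).ncard = X.card + 1 ∧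
      ∃ b ∈ R, b ≠ c ∧ w c b +ᵥ pathWeights w u X c = pathWeights w u X b := by
    intro c hc
    obtain ⟨hcS, hcu, hcX⟩ := hRmem hc
    have hcard : (insert c X).card = X.card + 1 := Finset.card_insert_of_notMem hcX
    obtain ⟨b, hb, hbc⟩ := hextend (Y := insert c X)
      (Finset.insert_subset (Finset.mem_erase.2 ⟨hcu, hcS⟩) hXS) (by omega) (by omega)
    rw [hcard] at hbc
    simp only [Finset.mem_sdiff, Finset.mem_insert, not_or] at hb
    have hbR : b ∈ R := Finset.mem_sdiff.2 ⟨hb.1, hb.2.2⟩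
    have s1 := vadd_pathWeights_subset w hcu hcX b
    have s2 := pathWeights_mono w (u := u) (Finset.subset_insert c X) b
    have c1 := Set.ncard_le_ncard s1
    have c2 := Set.ncard_le_ncard s2
    rw [hvcard] at c1
    have m1 := hXw c hc
    have m2 := hXw b hbR
    refine ⟨by omega, b, hbR, hb.2.1, ?_⟩
    rw [Set.eq_of_subset_of_ncard_le s1 (by rw [hvcard]; omega),
      Set.eq_of_subset_of_ncard_le s2 (by omega)]
  have hperiod : ∀ c ∈ R, ∃ h : G, h ≠ 0 ∧ h +ᵥ pathWeights w u X c = pathWeights w u X c :=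
    fun c hc => exists_period w (pathWeights w u X) (fun h => hzero (h.mono hRS))
      (fun c hc => (htight c hc).2) hc
  -- A non-translating edge `c d` would allow `c` and `d` to be added together.
  have hflat : ∀ c ∈ R, ∀ d ∈ R, d ≠ c →
      w c d +ᵥ pathWeights w u X c = pathWeights w u X d := by
    intro c hc d hd hdc
    by_contra hne
    obtain ⟨hcS, hcu, hcX⟩ := hRmem hc
    obtain ⟨hdS, hdu, hdX⟩ := hRmem hd
    obtain ⟨h, hh0, hh⟩ := hperiod c hc
    obtain ⟨h', hh0', hh'⟩ := hperiod d hd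
    have hgain := ncard_add_two_le_ncard_union (A := w c d +ᵥ pathWeights w u X c)
      hh0 hh0' (by rw [vadd_comm, hh]) hh' (by rw [hvcard, (htight c hc).1, (htight d hd).1]) hne
    rw [hvcard, (htight c hc).1] at hgain
    have hd1 := Set.ncard_le_ncard (Set.union_subset (vadd_pathWeights_subset w hcu hcX d)
      (pathWeights_mono w (u := u) (Finset.subset_insert c X) d))
    have hd2 := Set.ncard_le_card (pathWeights w u (insert c X) d)
    have hdX' : d ∉ insert c X := by simp [hdc, hdX]
    have hcard1 : (insert c X).card = X.card + 1 := Finset.card_insert_of_notMem hcX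
    have hcard2 : (insert d (insert c X)).card = X.card + 2 := by
      rw [Finset.card_insert_of_notMem hdX', hcard1]
    obtain ⟨b, -, hbc⟩ := hextend (Y := insert d (insert c X))
      (Finset.insert_subset (Finset.mem_erase.2 ⟨hdu, hdS⟩)
        (Finset.insert_subset (Finset.mem_erase.2 ⟨hcu, hcS⟩) hXS)) (by omega) (by omega)
    have hb1 := Set.ncard_le_ncard (vadd_pathWeights_subset w hdu hdX' b)
    rw [hvcard] at hb1
    omega
  -- All edges of `R` are translating: up to a potential, their weights lie in a stabilizer.
  set A := pathWeights w u X r with hA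
  have hH := card_stabilizer_add_ncard_le (hproper r hr)
  rw [← hA, (htight r hr).1] at hH
  let t : V → G := fun b => if b = r then 0 else w r b
  have ht : ∀ b ∈ R, t b +ᵥ A = pathWeights w u X b := fun b hb => by
    by_cases hbr : b = r
    · simp [t, hbr, hA]
    · simpa [t, hbr] using hflat r hr b hb hbr
  have hmem : ∀ a ∈ R, ∀ b ∈ R, a ≠ b → w a b - (t b - t a) ∈ AddAction.stabilizer G A := by
    intro a ha b hb hab
    have h1 := hflat a ha b hb hab.symm
    rw [← ht a ha, ← ht b hb, ← add_vadd] at h1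
    rw [AddAction.mem_stabilizer_iff, show w a b - (t b - t a) = -t b + (w a b + t a) by abel,
      add_vadd, h1, neg_vadd_vadd]
  let w' : V → V → AddAction.stabilizer G A := fun a b =>
    if h : w a b - (t b - t a) ∈ AddAction.stabilizer G A then ⟨_, h⟩ else 0
  refine hzero (HasZeroCycle.mono (HasZeroCycle.of_subgroup w t w' ?_ ?_) hRS)
  · intro a ha b hb hab
    simp only [w', dif_pos (hmem a ha b hb hab), sub_add_cancel]
  · exact ih _ (by omega) w' R (by omega) rfl

end Main

/-! ### Complete digraphs weighted in `ZMod k` -/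

theorem exists_isDirectedCycle_cycleWeight_eq_zero {V : Type*} [Fintype V] (k : ℕ) [NeZero k]
    (wV : V → ZMod k) (wE : V → V → ZMod k) (h : k < Fintype.card V) :
    ∃ c : List V, IsDirectedCycle (completeDigraph V) c ∧ cycleWeight wV wE c = 0 := by
  obtain ⟨c, -, hl, hn, hs⟩ := hasZeroCycle_of_card_lt (fun x y => wV x + wE x y) Finset.univ
    (by simpa using h)
  refine ⟨c, ⟨hl, hn, fun e he => ne_of_mem_arcs hl hn he⟩, ?_⟩
  rw [List.sum_map_add, sum_map_fst_arcs wV c] at hs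
  exact hs

theorem le_of_mem_avoidingOrders {k n : ℕ} (hk : 0 < k) (hn : n ∈ avoidingOrders k) : n ≤ k := by
  have : NeZero k := ⟨hk.ne'⟩
  obtain ⟨wV, wE, hno⟩ := hn
  by_contra! hlt
  obtain ⟨c, hc, h0⟩ := exists_isDirectedCycle_cycleWeight_eq_zero k (fun x => (wV x : ZMod k))
    (fun x y => (wE x y : ZMod k)) (by simpa using hlt)
  refine hno ⟨c, hc, (ZMod.intCast_zmod_eq_zero_iff_dvd _ k).1 ?_⟩
  rw [← h0]
  simp [cycleWeight, List.map_map, Function.comp_def]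

end ZeroCycle

theorem theorem1 (k : ℕ) (hk : 2 ≤ k) :
    (∀ (V : Type*) [Fintype V] (wV : V → ZMod k) (wE : V → V → ZMod k),
      k + 2 * ArithmeticFunction.cardFactors k ≤ Fintype.card V →
        ∃ c : List V, ZeroCycle.IsDirectedCycle (ZeroCycle.completeDigraph V) c ∧
          ZeroCycle.cycleWeight wV wE c = 0) ∧
    IsGreatest (ZeroCycle.avoidingOrders k) (ZeroCycle.f k) ∧
    ZeroCycle.f k < k + 2 * ArithmeticFunction.cardFactors k := by
  have hΩ : 0 < ArithmeticFunction.cardFactors k :=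
    ArithmeticFunction.cardFactors_pos_iff_one_lt.2 hk
  have : NeZero k := ⟨by omega⟩
  have hle : ∀ n ∈ ZeroCycle.avoidingOrders k, n ≤ k := fun n hn =>
    ZeroCycle.le_of_mem_avoidingOrders (by omega) hn
  have hne : (ZeroCycle.avoidingOrders k).Nonempty := by
    refine ⟨0, 0, 0, ?_⟩
    rintro ⟨c, hc, -⟩
    rcases c with _ | ⟨x, -⟩
    · exact absurd hc.two_le_length (by simp)
    · exact x.elim0
  have hmem : ZeroCycle.f k ∈ ZeroCycle.avoidingOrders k := Nat.sSup_mem hne ⟨k, hle⟩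
  refine ⟨fun V _ wV wE hV => ?_, ⟨hmem, fun n hn => le_csSup ⟨k, hle⟩ hn⟩, ?_⟩
  · exact ZeroCycle.exists_isDirectedCycle_cycleWeight_eq_zero k wV wE (by omega)
  · have := hle _ hmem
    omega
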